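/- Let $d,n\ge 1$ be integers, $1\le r<\infty$, $s>2r$ and $\alpha\in(0,1)$. Let $\|\cdot\|$ be an arbitrary norm on $\mathbb R^{d+1}$ with dual norm $\|z\|_*=\sup_{\|w\|=1}\langle w,z\rangle$. Let $\rho:\mathbb R^d\to[0,\infty)$ be a penalty function with $\rho(0)=0$ and suppose that, for some constant $c_d>0$, $c_d\,\|(\gamma,-1)\|\le\rho(\gamma)+1$ for all $\gamma\in\mathbb R^d$. Let $\mathbb P$ be the law of a random vector $(\mathbf X,Y)$ with values in $\mathbb R^d\times\mathbb R$ such that $$\mathbb E_{\mathbb P}\big[\|(\mathbf X,0)\|_*^s\big]=1,\qquad \mathbb E_{\mathbb P}\big[\|(0,\dots,0,Y)\|_*^s\big]<\infty,$$ and put $\sigma=\max\{\mathbb E_{\mathbb P}[\|(0,\dots,0,Y)\|_*^s]^{1/s},\,1\}$. For probability measures $\mathbb P_1,\mathbb P_2$ on $\mathbb R^{d+1}$ define $$\widehat{\mathcal W}_r(\mathbb P_1,\mathbb P_2)=\sup_{\gamma\in\mathbb R^d}\ \inf_{\pi}\ \frac{1}{\sigma+\rho(\gamma)}\,\mathbb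 E_\pi\big[|(Y-\mathbf X^\top\gamma)-(\widetilde Y-\widetilde{\mathbf X}^\top\gamma)|^r\big]^{1/r}\in[0,\infty],$$ where the infimum is over all couplings $\pi$ of $\mathbb P_1$ and $\mathbb P_2$, with $((\mathbf X,Y),(\widetilde{\mathbf X},\widetilde Y))\sim\pi$. Let $$\delta_{n,r}=\max\Big\{\frac1{c_d},1\Big\}\left[\frac{C\,(\log(2n+1))^{r/s}}{\sqrt n}\right]^{1/r},$$ $$C=2^r r\left(180\sqrt{d+2}+\sqrt{2\log\frac1\alpha}+\sqrt{\frac{2^s}{\alpha}}\;\frac{8}{s/2-r}\sqrt{\log\frac8\alpha+(d+2)}\right).$$ Let $\widehat{\mathbb P}_n$ be the empirical distribution of $n$ i.i.d. draws from $\mathbb P$. Then for every $\epsilon\ge0$ and every probability measure $\mathbb Q$ on $\mathbb R^{d+1}$ with $\widehat{\mathcal W}_r(\mathbb P,\mathbb Q)\le\epsilon$, with probability greater than $1-3\alpha$, $$\mathbb E_{\mathbb Q}\big[|Y-\mathbf X^\top\beta|^r\big]^{1/r}\le\mathbb E_{\widehat{\mathbb P}_n}\big[|Y-\mathbf X^\top\beta|^r\big]^{1/r}+(\delta_{n,r}+\epsilon)\,(\sigma+\rho(\beta))\qquad\text{for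 all }\beta\in\mathbb R^d .$$ In particular $\delta_{n,r}$ does not depend on $\mathbb P$, and $\sigma$ depends on $\mathbb P$ only through the $s$-th moment of $Y$. -/

import Mathlib

open MeasureTheory ProbabilityTheory
open scoped ENNReal

namespace RhoMSW

noncomputable section

/-- Data points `(x, y)` consisting of a covariate vector `x ∈ ℝ^d` and an outcome `y ∈ ℝ`,
i.e. the space `ℝ^(d+1)`. -/
abbrev Point (d : ℕ) : Type := (Fin d → ℝ) × ℝ

/-- The standard inner product on `ℝ^(d+1) = ℝ^d × ℝ`. -/
def pairing {d : ℕ} (z w : Point d) : ℝ := dotProduct z.1 w.1 + z.2 * w.2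

/-- The dual `‖z‖_* = sup_{‖w‖ = 1} ⟨w, z⟩` of a norm on `ℝ^(d+1)`. -/
def dualNorm {d : ℕ} (N : Seminorm ℝ (Point d)) (z : Point d) : ℝ :=
  sSup ((fun w => pairing w z) '' {w | N w = 1})

/-- The prediction error `y - xᵀ β` of the linear predictor with coefficients `β`. -/
def predResidual {d : ℕ} (β : Fin d → ℝ) (z : Point d) : ℝ := z.2 - dotProduct z.1 β

/-- The `r`-th norm `E_P[|Y - Xᵀ β|^r]^(1/r) ∈ [0, ∞]` of the prediction error under `P`. -/
def predictionError {d : ℕ} (r : ℝ) (P : Measure (Point d)) (β : Fin d → ℝ) : ℝ≥0∞ :=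
  eLpNorm (predResidual β) (ENNReal.ofReal r) P

/-- `π` is a coupling of `P` and `Q`: its two marginals are `P` and `Q`. -/
def IsCoupling {E : Type*} [MeasurableSpace E] (π : Measure (E × E)) (P Q : Measure E) : Prop :=
  π.fst = P ∧ π.snd = Q

/-- The `ρ`-max-sliced Wasserstein distance
`sup_γ inf_π E_π[|(Y - Xᵀ γ) - (Y' - X'ᵀ γ)|^r]^(1/r) / (σ + ρ γ)`, with `π` ranging over the
couplings of `P` and `Q`. It takes values in `[0, ∞]`. -/
def rhoMSW {d : ℕ} (r : ℝ) (ρ : (Fin d → ℝ) → ℝ) (σ : ℝ) (P Q : Measure (Point d)) : ℝ≥0∞ :=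
  ⨆ γ : Fin d → ℝ, ⨅ (π : Measure (Point d × Point d)) (_ : IsCoupling π P Q),
    eLpNorm (fun zz => predResidual γ zz.1 - predResidual γ zz.2) (ENNReal.ofReal r) π
      / ENNReal.ofReal (σ + ρ γ)

/-- The empirical distribution `(1/n) ∑ᵢ δ_{zᵢ}` of the sample `z₁, …, zₙ`. -/
def empiricalMeasure {E : Type*} [MeasurableSpace E] {n : ℕ} (z : Fin n → E) : Measure E :=
  (n : ℝ≥0∞)⁻¹ • ∑ i, Measure.dirac (z i)

/-- The explicit constant `C`; it depends only on `r`, `s`, `α` and `d`. -/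
def pivotalConstant (r s α : ℝ) (d : ℕ) : ℝ :=
  2 ^ r * r * (180 * √((d : ℝ) + 2) + √(2 * Real.log (1 / α))
    + √(2 ^ s / α) * (8 / (s / 2 - r)) * √(Real.log (8 / α) + ((d : ℝ) + 2)))

/-- The regularization parameter
`δ_{n,r} = max(1/c_d, 1) * [C * (log (2n+1))^(r/s) / √n]^(1/r)`. -/
def pivotalRadius (r s α c : ℝ) (d n : ℕ) : ℝ :=
  max (1 / c) 1 *
    (pivotalConstant r s α d * Real.log (2 * (n : ℝ) + 1) ^ (r / s) / √(n : ℝ)) ^ (1 / r)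

end

end RhoMSW

namespace RhoMSW

/-! The passage from `Q` to `P` is Minkowski's inequality under each coupling
(`predictionError_le_add_rhoMSW`); the probabilistic content is the passage from `P` to the
empirical measure, uniformly in `β`.

With κ = max(1/c, 1), the residuals divided by κ(σ + ρ β) are linear functionals of (β, -1) in a
space of dimension d + 1. Duality of norms puts all of them below one envelope F, the dual norm of
the covariate part plus 1/σ times that of the outcome part (`abs_pairing_le_envelope`). Minkowski in
L^s gives E F^(2r) ≤ 4^r (`lintegral_envelope_rpow_le`).

A second-moment argument then suffices. Symmetrization introduces random signs. On [-F, F] the map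
|·|^r has Lipschitz constant r F^(r-1), so the contraction principle replaces r-th powers by linear
functionals with sample-dependent weights. The resulting vectors lie in a subspace of dimension at
most d + 1, where Cauchy–Schwarz bounds the Rademacher supremum by the dimension
(`sum_sq_sup_boolSign_rpow_le`). Chebyshev gives `measure_uniform_deviation_le`, and the third
summand of C alone makes the failure probability less than 3α. -/

/-! ### Contraction principle for Rademacher sums -/

/-- Increments of a monotone convex function grow with the base point and the step. -/
theorem increment_le_of_convexOn {G : ℝ → ℝ} (hG : ConvexOn ℝ Set.univ G) (hmono : Monotone G)
    {x y p q : ℝ} (hxy : x ≤ y) (hp : 0 ≤ p) (hpq : p ≤ q) :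
    G (x + p) + G y ≤ G (y + q) + G x := by
  suffices h : G (x + p) + G y ≤ G (y + p) + G x by
    have := hmono (show y + p ≤ y + q by linarith)
    linarith
  rcases eq_or_lt_of_le (show x ≤ y + p by linarith) with h | h
  · have hp0 : p = 0 := by linarith
    have hy : y = x := by linarith
    simp [hp0, hy]
  have hpos : 0 < y + p - x := by linarith
  -- The points x + p and y are convex combinations of x and y + p with interchanged weights, so
  -- adding the two convexity inequalities gives the claim.
  have hr : 0 ≤ (y - x) / (y + p - x) := div_nonneg (by linarith) hpos.le
  have hs : 0 ≤ p / (y + p - x) := div_nonneg hp hpos.le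
  have h1 := hG.2 (Set.mem_univ x) (Set.mem_univ (y + p)) hr hs (by field_simp; ring)
  have h2 := hG.2 (Set.mem_univ x) (Set.mem_univ (y + p)) hs hr (by field_simp; ring)
  simp only [smul_eq_mul] at h1 h2
  have e1 : (y - x) / (y + p - x) * x + p / (y + p - x) * (y + p) = x + p := by
    field_simp; ring
  have e2 : p / (y + p - x) * x + (y - x) / (y + p - x) * (y + p) = y := by
    field_simp; ring
  rw [e1] at h1
  rw [e2] at h2
  have e3 : (y - x) / (y + p - x) + p / (y + p - x) = 1 := by field_simp; ring
  have e4 : (y - x) / (y + p - x) = 1 - p / (y + p - x) := by linarith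
  rw [e4] at h1 h2
  nlinarith

/-- The two-point step of the contraction principle, for two maximizers `t` and `u`. -/
theorem contraction_two_point_aux {G : ℝ → ℝ} (hG : ConvexOn ℝ Set.univ G) (hmono : Monotone G)
    {ct cu at' au bt bu S D : ℝ} (h1 : cu + au ≤ ct + at') (h2 : ct - at' ≤ cu - au)
    (hab : |at' - au| ≤ |bt - bu|) (hat : |at'| ≤ |bt|) (hau : |au| ≤ |bu|)
    (hSt : ct + bt ≤ S) (hSu : cu + bu ≤ S) (hDt : ct - bt ≤ D) (hDu : cu - bu ≤ D) :
    G (ct + at') + G (cu - au) ≤ G S + G D := by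
  -- Negating both b-values exchanges the roles of S and D.
  wlog hbt : 0 ≤ bt generalizing bt bu S D
  · have := this (bt := -bt) (bu := -bu) (S := D) (D := S)
      (by rw [← abs_neg (bt - bu)] at hab; convert hab using 2; ring) (by simpa using hat)
      (by simpa using hau) (by linarith) (by linarith) (by linarith) (by linarith) (by linarith)
    linarith
  have hat' := abs_le.1 hat
  have hau' := abs_le.1 hau
  rw [abs_of_nonneg hbt] at hat'
  rcases le_total 0 bu with hbu | hbu
  · rw [abs_of_nonneg hbu] at hau'
    rcases le_total bu bt with h | h
    · rw [abs_of_nonneg (sub_nonneg.2 h)] at hab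
      have hab' := abs_le.1 hab
      have := increment_le_of_convexOn hG hmono (x := cu - bu) (y := ct + at') (p := bu - au)
        (q := bt - at') (by linarith) (by linarith) (by linarith)
      have e1 : cu - bu + (bu - au) = cu - au := by ring
      have e2 : ct + at' + (bt - at') = ct + bt := by ring
      rw [e1, e2] at this
      have := hmono hSt
      have := hmono hDu
      linarith
    · rw [abs_sub_comm bt bu, abs_of_nonneg (sub_nonneg.2 h)] at hab
      have hab' := abs_le.1 hab
      have := increment_le_of_convexOn hG hmono (x := ct - bt) (y := cu - au) (p := at' + bt)
        (q := au + bu) (by linarith) (by linarith) (by linarith)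
      have e1 : ct - bt + (at' + bt) = ct + at' := by ring
      have e2 : cu - au + (au + bu) = cu + bu := by ring
      rw [e1, e2] at this
      have := hmono hSu
      have := hmono hDt
      linarith
  -- With opposite signs convexity is not needed: each argument on the left is already below S or D
  -- respectively.
  · rw [abs_of_nonpos hbu] at hau'
    have := hmono (show ct + at' ≤ S by linarith)
    have := hmono (show cu - au ≤ D by linarith)
    linarith

/-- Finiteness of J makes both left-hand suprema attained; maximality of the two indices supplies
the order hypotheses of `contraction_two_point_aux`. -/
theorem contraction_two_point {J : Type*} [Finite J] [Nonempty J] {G : ℝ → ℝ}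
    (hG : ConvexOn ℝ Set.univ G) (hmono : Monotone G) (c a b : J → ℝ)
    (hab : ∀ j k, |a j - a k| ≤ |b j - b k|) (ha : ∀ j, |a j| ≤ |b j|) :
    G (⨆ j, (c j + a j)) + G (⨆ j, (c j - a j))
      ≤ G (⨆ j, (c j + b j)) + G (⨆ j, (c j - b j)) := by
  have hle : ∀ (f : J → ℝ) j, f j ≤ ⨆ j, f j := fun f j =>
    le_ciSup (Set.finite_range f).bddAbove j
  obtain ⟨t, ht⟩ := exists_eq_ciSup_of_finite (f := fun j => c j + a j)
  obtain ⟨u, hu⟩ := exists_eq_ciSup_of_finite (f := fun j => c j - a j)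
  have h1 := hle (fun j => c j + a j) u
  have h2 := hle (fun j => c j - a j) t
  rw [← ht] at h1 ⊢
  rw [← hu] at h2 ⊢
  exact contraction_two_point_aux hG hmono h1 h2 (hab t u) (ha t) (ha u)
    (hle (fun j => c j + b j) t) (hle (fun j => c j + b j) u)
    (hle (fun j => c j - b j) t) (hle (fun j => c j - b j) u)

/-- The sign `±1` attached to a Boolean. -/
def boolSign (e : Bool) : ℝ := if e then 1 else -1

theorem sum_bool_fun_succ {n : ℕ} (f : (Fin (n + 1) → Bool) → ℝ) :
    ∑ e, f e = ∑ e : Fin n → Bool, (f (Fin.cons true e) + f (Fin.cons false e)) := by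
  rw [← (Fin.consEquiv (fun _ : Fin (n + 1) => Bool)).sum_comp f, Fintype.sum_prod_type,
    Fintype.sum_bool, Finset.sum_add_distrib]
  rfl

/-- The contraction principle for Rademacher averages. -/
theorem contraction_principle {J : Type*} [Finite J] [Nonempty J] {G : ℝ → ℝ}
    (hG : ConvexOn ℝ Set.univ G) (hmono : Monotone G) {n : ℕ} (c : J → ℝ) (a b : Fin n → J → ℝ)
    (hab : ∀ i j k, |a i j - a i k| ≤ |b i j - b i k|) (ha : ∀ i j, |a i j| ≤ |b i j|) :
    ∑ e : Fin n → Bool, G (⨆ j, (c j + ∑ i, boolSign (e i) * a i j))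
      ≤ ∑ e : Fin n → Bool, G (⨆ j, (c j + ∑ i, boolSign (e i) * b i j)) := by
  induction n generalizing c with
  | zero => simp
  | succ n ih =>
    -- Conditioning on the first sign absorbs its term into the offset c, which is why the statement
    -- carries an offset. The induction hypothesis then exchanges the tail, and the two-point
    -- inequality exchanges the head.
    have key : ∀ a' : Fin (n + 1) → J → ℝ,
        ∑ e : Fin (n + 1) → Bool, G (⨆ j, (c j + ∑ i, boolSign (e i) * a' i j))
        = ∑ e : Fin n → Bool, G (⨆ j, ((c j + a' 0 j) + ∑ i, boolSign (e i) * a' i.succ j))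
        + ∑ e : Fin n → Bool, G (⨆ j, ((c j - a' 0 j) + ∑ i, boolSign (e i) * a' i.succ j)) := by
      intro a'
      rw [sum_bool_fun_succ, Finset.sum_add_distrib]
      simp only [Fin.sum_univ_succ, Fin.cons_zero, Fin.cons_succ, boolSign, if_true,
        Bool.false_eq_true, if_false, one_mul, neg_one_mul, add_assoc, sub_eq_add_neg]
    have h1 := ih (fun j => c j + a 0 j) (fun i => a i.succ) (fun i => b i.succ)
      (fun i => hab i.succ) (fun i => ha i.succ)
    have h2 := ih (fun j => c j - a 0 j) (fun i => a i.succ) (fun i => b i.succ)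
      (fun i => hab i.succ) (fun i => ha i.succ)
    have h3 : ∀ e : Fin n → Bool,
        G (⨆ j, ((c j + a 0 j) + ∑ i, boolSign (e i) * b i.succ j))
          + G (⨆ j, ((c j - a 0 j) + ∑ i, boolSign (e i) * b i.succ j))
        ≤ G (⨆ j, ((c j + b 0 j) + ∑ i, boolSign (e i) * b i.succ j))
          + G (⨆ j, ((c j - b 0 j) + ∑ i, boolSign (e i) * b i.succ j)) := by
      intro e
      have := contraction_two_point hG hmono (fun j => c j + ∑ i, boolSign (e i) * b i.succ j)
        (a 0) (b 0) (hab 0) (ha 0)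
      convert this using 5 <;> ring
    have h4 := Finset.sum_le_sum fun e (_ : e ∈ (Finset.univ : Finset (Fin n → Bool))) => h3 e
    rw [Finset.sum_add_distrib, Finset.sum_add_distrib] at h4
    rw [key a, key b]
    linarith

/-! ### Second moments of Rademacher suprema -/

/-- Orthogonality of independent signs: the cross terms cancel when the two values of a sign are
added. The offset c is there for the induction. -/
theorem sum_sq_add_boolSign {n : ℕ} (c : ℝ) (u : Fin n → ℝ) :
    ∑ e : Fin n → Bool, (c + ∑ i, boolSign (e i) * u i) ^ 2 = 2 ^ n * (c ^ 2 + ∑ i, u i ^ 2) := by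
  induction n generalizing c with
  | zero => simp
  | succ n ih =>
    rw [sum_bool_fun_succ, Finset.sum_add_distrib]
    simp only [Fin.sum_univ_succ, Fin.cons_zero, Fin.cons_succ, boolSign, if_true,
        Bool.false_eq_true, if_false, one_mul, neg_one_mul, ← add_assoc]
    have h1 := ih (c + u 0) (fun i => u i.succ)
    have h2 := ih (c + -u 0) (fun i => u i.succ)
    simp only [boolSign] at h1 h2
    rw [h1, h2]
    ring

theorem sum_sq_boolSign {n : ℕ} (u : Fin n → ℝ) :
    ∑ e : Fin n → Bool, (∑ i, boolSign (e i) * u i) ^ 2 = 2 ^ n * ∑ i, u i ^ 2 := by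
  simpa using sum_sq_add_boolSign 0 u

/-- The second moment of the supremum of a Rademacher process indexed by vectors of a
`k`-dimensional subspace is at most `k` times the squared radius of the index set. -/
theorem sum_sq_sup_boolSign_le {J : Type*} [Finite J] [Nonempty J] {n : ℕ}
    (W : Submodule ℝ (EuclideanSpace ℝ (Fin n))) (U : J → EuclideanSpace ℝ (Fin n))
    (hU : ∀ j, U j ∈ W) {V : ℝ} (hV : ∀ j, ∑ i, U j i ^ 2 ≤ V) :
    ∑ e : Fin n → Bool, (max (⨆ j, ∑ i, boolSign (e i) * U j i) 0) ^ 2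
      ≤ 2 ^ n * (Module.finrank ℝ W * V) := by
  -- Expanding each vector in an orthonormal basis of W and applying Cauchy–Schwarz separates the
  -- signs from the index j. The supremum then costs only the sum over basis vectors, each of which
  -- averages to 1.
  set b := stdOrthonormalBasis ℝ W
  have hV0 : 0 ≤ V := (Finset.sum_nonneg fun i _ => sq_nonneg _).trans (hV (Classical.arbitrary J))
  have hpt : ∀ e : Fin n → Bool, (max (⨆ j, ∑ i, boolSign (e i) * U j i) 0) ^ 2
      ≤ (∑ k, (∑ i, boolSign (e i) * (b k : EuclideanSpace ℝ (Fin n)) i) ^ 2) * V := by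
    intro e
    have h0 : 0 ≤ (∑ k, (∑ i, boolSign (e i) * (b k : EuclideanSpace ℝ (Fin n)) i) ^ 2) * V :=
      mul_nonneg (Finset.sum_nonneg fun i _ => sq_nonneg _) hV0
    obtain ⟨j, hj⟩ := exists_eq_ciSup_of_finite (f := fun j => ∑ i, boolSign (e i) * U j i)
    rw [← hj]
    have hexp : U j = ∑ k, inner ℝ (b k) (⟨U j, hU j⟩ : W) • (b k : EuclideanSpace ℝ (Fin n)) := by
      have := congrArg (Subtype.val) (b.sum_repr' ⟨U j, hU j⟩)
      simpa using this.symm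
    have hnorm : ∑ k, inner ℝ (b k) (⟨U j, hU j⟩ : W) ^ 2 ≤ V := by
      have h := b.sum_sq_norm_inner_right (⟨U j, hU j⟩ : W)
      simp only [Real.norm_eq_abs, sq_abs] at h
      rw [h, Submodule.coe_norm, EuclideanSpace.norm_sq_eq]
      simpa using hV j
    have hlin : ∑ i, boolSign (e i) * U j i = ∑ k, (∑ i, boolSign (e i) *
        (b k : EuclideanSpace ℝ (Fin n)) i) * inner ℝ (b k) (⟨U j, hU j⟩ : W) := by
      have hi : ∀ i, U j i = ∑ k, inner ℝ (b k) (⟨U j, hU j⟩ : W) *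
          (b k : EuclideanSpace ℝ (Fin n)) i := by
        intro i
        conv_lhs => rw [hexp]
        simp
      simp only [hi, Finset.mul_sum, Finset.sum_mul]
      rw [Finset.sum_comm]
      refine Finset.sum_congr rfl fun k _ => Finset.sum_congr rfl fun i _ => by ring
    have hcs := Finset.sum_mul_sq_le_sq_mul_sq Finset.univ
      (fun k => ∑ i, boolSign (e i) * (b k : EuclideanSpace ℝ (Fin n)) i)
      (fun k => inner ℝ (b k) (⟨U j, hU j⟩ : W))
    rw [← hlin] at hcs
    rcases le_total 0 (∑ i, boolSign (e i) * U j i) with h | h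
    · rw [max_eq_left h]
      exact hcs.trans (mul_le_mul_of_nonneg_left hnorm (Finset.sum_nonneg fun i _ => sq_nonneg _))
    · rw [max_eq_right h]
      simpa using h0
  refine (Finset.sum_le_sum fun e _ => hpt e).trans_eq ?_
  rw [← Finset.sum_mul, Finset.sum_comm]
  have hb : ∀ k, ∑ i, (b k : EuclideanSpace ℝ (Fin n)) i ^ 2 = 1 := by
    intro k
    have h := b.norm_eq_one k
    rw [Submodule.coe_norm] at h
    have h2 := EuclideanSpace.norm_sq_eq (b k : EuclideanSpace ℝ (Fin n))
    rw [h] at h2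
    simpa using h2.symm
  simp only [sum_sq_boolSign, hb, mul_one, Finset.sum_const, Finset.card_univ, Fintype.card_fin,
    nsmul_eq_mul]
  ring

theorem monotone_max_zero_sq : Monotone fun x : ℝ => (max x 0) ^ 2 := fun x y h => by
  have : max x 0 ≤ max y 0 := max_le_max_right 0 h
  exact pow_le_pow_left₀ (le_max_right _ _) this 2

theorem convexOn_max_zero_sq : ConvexOn ℝ Set.univ fun x : ℝ => (max x 0) ^ 2 :=
  ((convexOn_id convex_univ).sup (convexOn_const 0 convex_univ)).pow
    (fun _ _ => le_max_right _ _) 2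

/-- Mean value inequality for x ^ r on [0, F], where the derivative is at most r F^(r-1). Taking v =
0 also gives the bound on values required by the contraction principle. -/
theorem abs_rpow_abs_sub_le {r F u v : ℝ} (hr : 1 ≤ r) (hu : |u| ≤ F) (hv : |v| ≤ F) :
    |(|u| ^ r) - |v| ^ r| ≤ r * F ^ (r - 1) * |u - v| := by
  have hF : 0 ≤ F := (abs_nonneg u).trans hu
  have h := (convex_Icc (0 : ℝ) F).norm_image_sub_le_of_norm_hasDerivWithin_le
    (f := fun x : ℝ => x ^ r) (f' := fun x : ℝ => r * x ^ (r - 1)) (C := r * F ^ (r - 1))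
    (fun x _ => (Real.hasDerivAt_rpow_const (Or.inr hr)).hasDerivWithinAt)
    (fun x hx => by
      rw [Real.norm_of_nonneg (mul_nonneg (by linarith) (Real.rpow_nonneg hx.1 _))]
      exact mul_le_mul_of_nonneg_left (Real.rpow_le_rpow hx.1 hx.2 (by linarith)) (by linarith))
    (⟨abs_nonneg v, hv⟩ : |v| ∈ Set.Icc 0 F) (⟨abs_nonneg u, hu⟩ : |u| ∈ Set.Icc 0 F)
  refine h.trans (mul_le_mul_of_nonneg_left (abs_abs_sub_abs_le u v) ?_)
  exact mul_nonneg (by linarith) (Real.rpow_nonneg hF _)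

/-- The Rademacher process of the `r`-th powers of a family of linear functionals, evaluated at
points with envelope values `F i`. -/
theorem sum_sq_sup_boolSign_rpow_le {J V : Type*} [Finite J] [Nonempty J] [AddCommGroup V]
    [Module ℝ V] [FiniteDimensional ℝ V] {n : ℕ} {r : ℝ} (hr : 1 ≤ r) (ℓ : Fin n → V →ₗ[ℝ] ℝ)
    (θ : J → V) (F : Fin n → ℝ) (hF : ∀ i j, |ℓ i (θ j)| ≤ F i) {t : ℝ} (ht : |t| = 1) :
    ∑ e : Fin n → Bool, (max (⨆ j, ∑ i, boolSign (e i) * (t * |ℓ i (θ j)| ^ r)) 0) ^ 2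
      ≤ 2 ^ n * (Module.finrank ℝ V * (r ^ 2 * ∑ i, F i ^ (2 * r))) := by
  have hF0 : ∀ i, 0 ≤ F i := fun i => (abs_nonneg _).trans (hF i (Classical.arbitrary J))
  have hL0 : ∀ i, 0 ≤ r * F i ^ (r - 1) := fun i =>
    mul_nonneg (by linarith) (Real.rpow_nonneg (hF0 i) _)
  have hsq : ∀ i, (r * F i ^ (r - 1) * F i) ^ 2 = r ^ 2 * F i ^ (2 * r) := fun i => by
    rw [mul_assoc, ← Real.rpow_add_one' (hF0 i) (by linarith), sub_add_cancel, mul_pow,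
      mul_comm 2 r, Real.rpow_mul (hF0 i)]
    norm_num
  -- Scaling coordinate i by its own Lipschitz constant keeps the comparison process linear in the
  -- parameter, so its vectors lie in a range of dimension at most that of V.
  set A : V →ₗ[ℝ] EuclideanSpace ℝ (Fin n) :=
    (WithLp.linearEquiv 2 ℝ (Fin n → ℝ)).symm.toLinearMap ∘ₗ
      LinearMap.pi fun i => (r * F i ^ (r - 1)) • ℓ i with hA
  have hAapp : ∀ v i, A v i = r * F i ^ (r - 1) * ℓ i v := fun v i => rfl
  have hcontr := contraction_principle (J := J) convexOn_max_zero_sq monotone_max_zero_sq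
    (fun _ => 0) (fun i j => t * |ℓ i (θ j)| ^ r) (fun i j => A (θ j) i)
    (fun i j k => by
      rw [← mul_sub, abs_mul, ht, one_mul, hAapp, hAapp, ← mul_sub, abs_mul, abs_of_nonneg (hL0 i)]
      exact abs_rpow_abs_sub_le hr (hF i j) (hF i k))
    (fun i j => by
      have := abs_rpow_abs_sub_le (v := 0) hr (hF i j) (by simpa using hF0 i)
      rw [abs_zero, Real.zero_rpow (by linarith), sub_zero, sub_zero] at this
      rw [abs_mul, ht, one_mul, hAapp, abs_mul, abs_of_nonneg (hL0 i)]
      exact this)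
  simp only [zero_add] at hcontr
  refine hcontr.trans ?_
  have hsub := sum_sq_sup_boolSign_le (LinearMap.range A) (fun j => A (θ j))
    (fun j => LinearMap.mem_range_self A _) (V := r ^ 2 * ∑ i, F i ^ (2 * r)) (fun j => by
      rw [Finset.mul_sum]
      refine Finset.sum_le_sum fun i _ => ?_
      rw [hAapp, ← hsq, ← sq_abs, abs_mul, abs_of_nonneg (hL0 i)]
      have := mul_le_mul_of_nonneg_left (hF i j) (hL0 i)
      exact pow_le_pow_left₀ (mul_nonneg (hL0 i) (abs_nonneg _)) this 2)
  refine hsub.trans (mul_le_mul_of_nonneg_left (mul_le_mul_of_nonneg_right ?_ ?_) (by positivity))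
  · exact_mod_cast LinearMap.finrank_range_le A
  · exact mul_nonneg (sq_nonneg _) (Finset.sum_nonneg fun i _ => Real.rpow_nonneg (hF0 i) _)

/-! ### Symmetrization -/

theorem lintegral_sq_le_lintegral_sq {E : Type*} [MeasurableSpace E] (P : Measure E)
    [IsProbabilityMeasure P] {f : E → ℝ≥0∞} (hf : AEMeasurable f P) :
    (∫⁻ x, f x ∂P) ^ 2 ≤ ∫⁻ x, f x ^ 2 ∂P := by
  have h := ENNReal.lintegral_mul_le_Lp_mul_Lq P Real.HolderConjugate.two_two hf
    (aemeasurable_const (b := (1 : ℝ≥0∞)))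
  simp only [Pi.mul_apply, mul_one, ENNReal.one_rpow, lintegral_const, measure_univ] at h
  calc (∫⁻ x, f x ∂P) ^ 2 ≤ ((∫⁻ x, f x ^ (2 : ℝ) ∂P) ^ (1 / 2 : ℝ)) ^ 2 := pow_le_pow_left' h 2
    _ = ∫⁻ x, f x ^ 2 ∂P := by
      rw [← ENNReal.rpow_natCast, ← ENNReal.rpow_mul]
      norm_num

theorem ofReal_integral_le_lintegral_ofReal {E : Type*} [MeasurableSpace E] {P : Measure E}
    {f : E → ℝ} (hf : Integrable f P) :
    ENNReal.ofReal (∫ x, f x ∂P) ≤ ∫⁻ x, ENNReal.ofReal (f x) ∂P := by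
  have h := ofReal_integral_eq_lintegral_ofReal hf.pos_part
    (Filter.Eventually.of_forall fun x => le_max_right _ _)
  calc ENNReal.ofReal (∫ x, f x ∂P) ≤ ENNReal.ofReal (∫ x, max (f x) 0 ∂P) :=
        ENNReal.ofReal_le_ofReal (integral_mono hf hf.pos_part fun x => le_max_left _ _)
    _ = ∫⁻ x, ENNReal.ofReal (f x) ∂P := by
      rw [h]
      exact lintegral_congr fun x => by simp

/-- Symmetrization: the one-sided deviation of the empirical process is controlled by its
Rademacher version on a doubled sample. -/
theorem symmetrization {E J : Type*} [MeasurableSpace E] (P : Measure E) [IsProbabilityMeasure P]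
    [Finite J] [Nonempty J] {n : ℕ} (h : J → E → ℝ) (hm : ∀ j, Measurable (h j))
    (hint : ∀ j, Integrable (h j) P) :
    2 ^ n * ∫⁻ z, ENNReal.ofReal (⨆ j, ∑ i, (∫ x, h j x ∂P - h j (z i))) ^ 2
        ∂(Measure.pi fun _ : Fin n => P)
      ≤ ∫⁻ w, ∑ e : Fin n → Bool, ENNReal.ofReal
          (⨆ j, ∑ i, boolSign (e i) * (h j (w i).2 - h j (w i).1)) ^ 2
        ∂(Measure.pi fun _ : Fin n => P.prod P) := by
  have : Countable J := Finite.to_countable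
  set D : (Fin n → E × E) → ℝ≥0∞ := fun w =>
    ENNReal.ofReal (⨆ j, ∑ i, (h j (w i).2 - h j (w i).1)) ^ 2 with hD
  have hDm : Measurable D := by
    refine (ENNReal.measurable_ofReal.comp ?_).pow_const 2
    refine Measurable.iSup fun j => Finset.measurable_sum _ fun i _ => ?_
    exact ((hm j).comp (measurable_snd.comp (measurable_pi_apply i))).sub
      ((hm j).comp (measurable_fst.comp (measurable_pi_apply i)))
  have hpair : ∀ z z' : Fin n → E, Measurable fun z' : Fin n → E =>
      ⨆ j, ∑ i, (h j (z' i) - h j (z i)) := fun z _ =>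
    Measurable.iSup fun j => Finset.measurable_sum _ fun i _ =>
      ((hm j).comp (measurable_pi_apply i)).sub measurable_const
  have hcoord : ∀ j (i : Fin n), Integrable (fun z' : Fin n → E => h j (z' i))
      (Measure.pi fun _ : Fin n => P) := fun j i =>
    ((measurePreserving_eval (fun _ : Fin n => P) i).integrable_comp
      (hm j).aestronglyMeasurable).2 (hint j)
  have hcoordint : ∀ j (i : Fin n), ∫ z', h j (z' i) ∂(Measure.pi fun _ : Fin n => P)
      = ∫ x, h j x ∂P := fun j i => by
    have := integral_map (μ := Measure.pi fun _ : Fin n => P)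
      (measurePreserving_eval (fun _ : Fin n => P) i).measurable.aemeasurable
      (f := h j) (hm j).aestronglyMeasurable
    rw [(measurePreserving_eval (fun _ : Fin n => P) i).map_eq] at this
    exact this.symm
  -- Ghost sample: for fixed z the supremum is attained at some j, whose centred sum is the mean
  -- over an independent copy z'. Jensen moves the square inside that mean.
  have hghost : ∀ z : Fin n → E,
      ENNReal.ofReal (⨆ j, ∑ i, (∫ x, h j x ∂P - h j (z i))) ^ 2
      ≤ ∫⁻ z', D (fun i => (z i, z' i)) ∂(Measure.pi fun _ : Fin n => P) := by
    intro z
    obtain ⟨j, hj⟩ := exists_eq_ciSup_of_finite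
      (f := fun j => ∑ i, (∫ x, h j x ∂P - h j (z i)))
    rw [← hj]
    refine le_trans ?_ (lintegral_sq_le_lintegral_sq _ (hpair z z).ennreal_ofReal.aemeasurable)
    refine pow_le_pow_left' ?_ 2
    have hterm : ∀ i : Fin n, Integrable (fun z' : Fin n → E => h j (z' i) - h j (z i))
        (Measure.pi fun _ : Fin n => P) := fun i => (hcoord j i).sub (integrable_const _)
    have hi : Integrable (fun z' : Fin n → E => ∑ i, (h j (z' i) - h j (z i)))
        (Measure.pi fun _ : Fin n => P) := integrable_finsetSum _ fun i _ => hterm i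
    have he : ∑ i, (∫ x, h j x ∂P - h j (z i))
        = ∫ z', ∑ i, (h j (z' i) - h j (z i)) ∂(Measure.pi fun _ : Fin n => P) := by
      rw [integral_finsetSum _ fun i _ => hterm i]
      refine Finset.sum_congr rfl fun i _ => ?_
      rw [integral_sub (hcoord j i) (integrable_const _), hcoordint]
      simp
    rw [he]
    refine (ofReal_integral_le_lintegral_ofReal hi).trans (lintegral_mono fun z' => ?_)
    exact ENNReal.ofReal_le_ofReal
      (le_ciSup (f := fun j => ∑ i, (h j (z' i) - h j (z i))) (Set.finite_range _).bddAbove j)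
  have hdouble : ∫⁻ z, ENNReal.ofReal (⨆ j, ∑ i, (∫ x, h j x ∂P - h j (z i))) ^ 2
        ∂(Measure.pi fun _ : Fin n => P)
      ≤ ∫⁻ w, D w ∂(Measure.pi fun _ : Fin n => P.prod P) := by
    refine (lintegral_mono hghost).trans_eq ?_
    have hmp := measurePreserving_arrowProdEquivProdArrow E E (Fin n) (fun _ => P) (fun _ => P)
    have hsym := hmp.symm
    rw [← hsym.lintegral_comp hDm]
    exact (lintegral_prod _ (hDm.comp hsym.measurable).aemeasurable).symm
  -- Interchanging the two halves of the pairs with negative sign preserves the product measure and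
  -- flips exactly those increments, so every sign pattern gives the same integral.
  have hswap : ∀ e : Fin n → Bool, ∫⁻ w, D w ∂(Measure.pi fun _ : Fin n => P.prod P)
      = ∫⁻ w, ENNReal.ofReal (⨆ j, ∑ i, boolSign (e i) * (h j (w i).2 - h j (w i).1)) ^ 2
        ∂(Measure.pi fun _ : Fin n => P.prod P) := by
    intro e
    have hmp := measurePreserving_pi (fun _ : Fin n => P.prod P) (fun _ : Fin n => P.prod P)
      (f := fun i => if e i then id else Prod.swap) (fun i => by
        cases e i
        · simpa using Measure.measurePreserving_swap
        · simpa using MeasurePreserving.id _)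
    rw [← hmp.lintegral_comp hDm]
    refine lintegral_congr fun w => ?_
    simp only [hD]
    congr 3
    funext j
    refine Finset.sum_congr rfl fun i _ => ?_
    cases hi : e i <;> simp [boolSign]
  calc _ ≤ 2 ^ n * ∫⁻ w, D w ∂(Measure.pi fun _ : Fin n => P.prod P) := by gcongr
    _ = ∑ _e : Fin n → Bool, ∫⁻ w, D w ∂(Measure.pi fun _ : Fin n => P.prod P) := by
      simp
    _ = _ := by
      rw [lintegral_finsetSum]
      · exact Finset.sum_congr rfl fun e _ => hswap e
      · intro e _
        refine (ENNReal.measurable_ofReal.comp ?_).pow_const 2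
        refine Measurable.iSup fun j => Finset.measurable_sum _ fun i _ => ?_
        exact measurable_const.mul (((hm j).comp (measurable_snd.comp (measurable_pi_apply i))).sub
          ((hm j).comp (measurable_fst.comp (measurable_pi_apply i))))

/-! ### Uniform deviation of r-th moments -/

theorem ofReal_sq_eq_ofReal_max_sq (x : ℝ) :
    ENNReal.ofReal x ^ 2 = ENNReal.ofReal ((max x 0) ^ 2) := by
  rw [ENNReal.ofReal_pow (le_max_right _ _), ENNReal.ofReal_max]
  simp

theorem max_ciSup_add_sq_le {J : Type*} [Finite J] [Nonempty J] (f g : J → ℝ) :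
    (max (⨆ j, (f j + g j)) 0) ^ 2 ≤ 2 * (max (⨆ j, f j) 0) ^ 2 + 2 * (max (⨆ j, g j) 0) ^ 2 := by
  have h : max (⨆ j, (f j + g j)) 0 ≤ max (⨆ j, f j) 0 + max (⨆ j, g j) 0 := by
    refine max_le (ciSup_le fun j => add_le_add ?_ ?_) (by positivity)
    · exact (le_ciSup (Set.finite_range f).bddAbove j).trans (le_max_left _ _)
    · exact (le_ciSup (Set.finite_range g).bddAbove j).trans (le_max_left _ _)
  have h0 : 0 ≤ max (⨆ j, (f j + g j)) 0 := le_max_right _ _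
  nlinarith [sq_nonneg (max (⨆ j, f j) 0 - max (⨆ j, g j) 0)]

/-- Second moment of the one-sided empirical process indexed by the `r`-th powers of finitely many
linear functionals with a common envelope `F`. -/
theorem lintegral_sq_empiricalProcess_le {E J V : Type*} [MeasurableSpace E] (P : Measure E)
    [IsProbabilityMeasure P] [Finite J] [Nonempty J] [AddCommGroup V] [Module ℝ V]
    [FiniteDimensional ℝ V] {n : ℕ} {r : ℝ} (hr : 1 ≤ r) (ℓ : E → V →ₗ[ℝ] ℝ) (θ : J → V)
    (F : E → ℝ) (hF : ∀ z j, |ℓ z (θ j)| ≤ F z) (hFm : AEMeasurable F P)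
    (hm : ∀ j, Measurable fun z => ℓ z (θ j)) (hint : ∀ j, Integrable (fun z => |ℓ z (θ j)| ^ r) P) :
    ∫⁻ z, ENNReal.ofReal (⨆ j, ∑ i, (∫ x, |ℓ x (θ j)| ^ r ∂P - |ℓ (z i) (θ j)| ^ r)) ^ 2
        ∂(Measure.pi fun _ : Fin n => P)
      ≤ ENNReal.ofReal (4 * (Module.finrank ℝ V * r ^ 2) * n)
        * ∫⁻ x, ENNReal.ofReal (F x ^ (2 * r)) ∂P := by
  have hF0 : ∀ z, 0 ≤ F z := fun z => (abs_nonneg _).trans (hF z (Classical.arbitrary J))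
  set K : ℝ := Module.finrank ℝ V * r ^ 2 with hK
  have hK0 : 0 ≤ K := by positivity
  have hsym := symmetrization (n := n) P (fun j z => |ℓ z (θ j)| ^ r)
    (fun j => (continuous_abs.measurable.comp (hm j)).pow_const r) hint
  have hpt : ∀ w : Fin n → E × E, ∑ e : Fin n → Bool, ENNReal.ofReal
      (⨆ j, ∑ i, boolSign (e i) * (|ℓ (w i).2 (θ j)| ^ r - |ℓ (w i).1 (θ j)| ^ r)) ^ 2
      ≤ 2 ^ n * (ENNReal.ofReal (2 * K) *
        ∑ i, (ENNReal.ofReal (F (w i).2 ^ (2 * r)) + ENNReal.ofReal (F (w i).1 ^ (2 * r)))) := by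
    intro w
    -- The two halves of the doubled sample are bounded separately, with t = 1 and t = -1. The final
    -- factor 4 is 2 from squaring a sum of two terms, times 2 for the two halves.
    have h2 := sum_sq_sup_boolSign_rpow_le hr (fun i => ℓ (w i).2) θ (fun i => F (w i).2)
      (fun i j => hF _ j) (t := 1) (by simp)
    have h1 := sum_sq_sup_boolSign_rpow_le hr (fun i => ℓ (w i).1) θ (fun i => F (w i).1)
      (fun i j => hF _ j) (t := -1) (by simp)
    have hreal : ∑ e : Fin n → Bool, (max (⨆ j, ∑ i, boolSign (e i) *
        (|ℓ (w i).2 (θ j)| ^ r - |ℓ (w i).1 (θ j)| ^ r)) 0) ^ 2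
        ≤ 2 ^ n * (2 * K * ∑ i, (F (w i).2 ^ (2 * r) + F (w i).1 ^ (2 * r))) := by
      have hsplit : ∀ e : Fin n → Bool, (max (⨆ j, ∑ i, boolSign (e i) *
          (|ℓ (w i).2 (θ j)| ^ r - |ℓ (w i).1 (θ j)| ^ r)) 0) ^ 2
          ≤ 2 * (max (⨆ j, ∑ i, boolSign (e i) * (1 * |ℓ (w i).2 (θ j)| ^ r)) 0) ^ 2
          + 2 * (max (⨆ j, ∑ i, boolSign (e i) * (-1 * |ℓ (w i).1 (θ j)| ^ r)) 0) ^ 2 := by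
        intro e
        have := max_ciSup_add_sq_le
          (fun j => ∑ i, boolSign (e i) * (1 * |ℓ (w i).2 (θ j)| ^ r))
          (fun j => ∑ i, boolSign (e i) * (-1 * |ℓ (w i).1 (θ j)| ^ r))
        simpa only [← Finset.sum_add_distrib, ← mul_add, one_mul, neg_one_mul,
          ← sub_eq_add_neg] using this
      refine (Finset.sum_le_sum fun e _ => hsplit e).trans ?_
      rw [Finset.sum_add_distrib, ← Finset.mul_sum, ← Finset.mul_sum, Finset.sum_add_distrib, hK]
      linarith
    simp only [ofReal_sq_eq_ofReal_max_sq]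
    rw [← ENNReal.ofReal_sum_of_nonneg fun e _ => sq_nonneg _]
    refine (ENNReal.ofReal_le_ofReal hreal).trans_eq ?_
    have hFr : ∀ z, 0 ≤ F z ^ (2 * r) := fun z => Real.rpow_nonneg (hF0 z) _
    rw [ENNReal.ofReal_mul (by positivity), ENNReal.ofReal_mul (by positivity),
      ENNReal.ofReal_sum_of_nonneg fun i _ => add_nonneg (hFr _) (hFr _)]
    simp only [ENNReal.ofReal_add (hFr _) (hFr _)]
    congr 1
    rw [ENNReal.ofReal_pow (by norm_num)]
    norm_num
  set I := ∫⁻ x, ENNReal.ofReal (F x ^ (2 * r)) ∂P with hI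
  have hFm' : AEMeasurable (fun x => ENNReal.ofReal (F x ^ (2 * r))) P :=
    (hFm.pow_const _).ennreal_ofReal
  have hmp2 : ∀ i : Fin n, MeasurePreserving (fun w : Fin n → E × E => (w i).2)
      (Measure.pi fun _ : Fin n => P.prod P) P := fun i =>
    measurePreserving_snd.comp (measurePreserving_eval (fun _ : Fin n => P.prod P) i)
  have hmp1 : ∀ i : Fin n, MeasurePreserving (fun w : Fin n → E × E => (w i).1)
      (Measure.pi fun _ : Fin n => P.prod P) P := fun i =>
    measurePreserving_fst.comp (measurePreserving_eval (fun _ : Fin n => P.prod P) i)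
  have hco : ∀ {f : (Fin n → E × E) → E}, MeasurePreserving f
      (Measure.pi fun _ : Fin n => P.prod P) P →
      AEMeasurable (fun w => ENNReal.ofReal (F (f w) ^ (2 * r)))
        (Measure.pi fun _ : Fin n => P.prod P) ∧
      ∫⁻ w, ENNReal.ofReal (F (f w) ^ (2 * r)) ∂(Measure.pi fun _ : Fin n => P.prod P) = I := by
    intro f hf
    refine ⟨hFm'.comp_quasiMeasurePreserving hf.quasiMeasurePreserving, ?_⟩
    have hFf := hFm'
    rw [← hf.map_eq] at hFf
    rw [hI, ← hf.map_eq, lintegral_map' hFf hf.measurable.aemeasurable, hf.map_eq]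
  have hfin : ∫⁻ w, 2 ^ n * (ENNReal.ofReal (2 * K) * ∑ i : Fin n,
        (ENNReal.ofReal (F (w i).2 ^ (2 * r)) + ENNReal.ofReal (F (w i).1 ^ (2 * r))))
        ∂(Measure.pi fun _ : Fin n => P.prod P)
      = 2 ^ n * (ENNReal.ofReal (4 * K * n) * I) := by
    have hterm : ∀ i : Fin n, AEMeasurable (fun w : Fin n → E × E =>
        ENNReal.ofReal (F (w i).2 ^ (2 * r)) + ENNReal.ofReal (F (w i).1 ^ (2 * r)))
        (Measure.pi fun _ : Fin n => P.prod P) := fun i => (hco (hmp2 i)).1.add (hco (hmp1 i)).1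
    rw [lintegral_const_mul' _ _ (by simp), lintegral_const_mul' _ _ ENNReal.ofReal_ne_top,
      lintegral_finsetSum' _ fun i _ => hterm i]
    have : ∀ i : Fin n, ∫⁻ w : Fin n → E × E, (ENNReal.ofReal (F (w i).2 ^ (2 * r))
        + ENNReal.ofReal (F (w i).1 ^ (2 * r))) ∂(Measure.pi fun _ : Fin n => P.prod P) = 2 * I := by
      intro i
      rw [lintegral_add_left' (hco (hmp2 i)).1, (hco (hmp2 i)).2, (hco (hmp1 i)).2, two_mul]
    simp only [this, Finset.sum_const, Finset.card_univ, Fintype.card_fin, nsmul_eq_mul]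
    have hconst : ENNReal.ofReal (4 * K * n) = ENNReal.ofReal (2 * K) * n * 2 := by
      rw [show 4 * K * (n : ℝ) = (2 * K) * n * 2 by ring, ENNReal.ofReal_mul (by positivity),
        ENNReal.ofReal_mul (q := (n : ℝ)) (by positivity), ENNReal.ofReal_natCast,
        ENNReal.ofReal_ofNat]
    rw [hconst]
    ring
  have hall := hsym.trans ((lintegral_mono hpt).trans_eq hfin)
  rwa [ENNReal.mul_le_mul_iff_right (by simp) (by simp)] at hall

/-- On a finite measure space, y ≤ 1 + y² with y = F^r gives integrability by domination. -/
theorem integrable_rpow_of_two_mul {E : Type*} [MeasurableSpace E] {P : Measure E}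
    [IsFiniteMeasure P] {r : ℝ} {F : E → ℝ} (hF0 : ∀ z, 0 ≤ F z) (hFm : AEMeasurable F P)
    (hI : ∫⁻ x, ENNReal.ofReal (F x ^ (2 * r)) ∂P ≠ ∞) : Integrable (fun x => F x ^ r) P := by
  have h2 : Integrable (fun x => F x ^ (2 * r)) P := by
    refine ⟨(hFm.pow_const _).aestronglyMeasurable, ?_⟩
    rw [hasFiniteIntegral_iff_ofReal
      (Filter.Eventually.of_forall fun x => Real.rpow_nonneg (hF0 x) _)]
    exact hI.lt_top
  refine ((integrable_const (1 : ℝ)).add h2).mono' (hFm.pow_const _).aestronglyMeasurable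
    (Filter.Eventually.of_forall fun x => ?_)
  rw [Real.norm_of_nonneg (Real.rpow_nonneg (hF0 x) _), Pi.add_apply, mul_comm 2 r,
    Real.rpow_mul (hF0 x), Real.rpow_two]
  nlinarith [sq_nonneg (F x ^ r - 1)]

/-- Uniform one-sided deviation inequality for the `r`-th absolute moments of all linear
functionals dominated by an envelope `F` with finite `2r`-th moment. -/
theorem measure_uniform_deviation_le {E V : Type*} [MeasurableSpace E] (P : Measure E)
    [IsProbabilityMeasure P] [NormedAddCommGroup V] [NormedSpace ℝ V] [FiniteDimensional ℝ V]
    {n : ℕ} {r : ℝ} (hr : 1 ≤ r) (ℓ : E → V →ₗ[ℝ] ℝ) (F : E → ℝ) (hF0 : ∀ z, 0 ≤ F z)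
    (hFm : AEMeasurable F P) (hm : ∀ v, Measurable fun z => ℓ z v)
    (hI : ∫⁻ x, ENNReal.ofReal (F x ^ (2 * r)) ∂P ≠ ∞) (u : ℝ) :
    ENNReal.ofReal u ^ 2 * (Measure.pi fun _ : Fin n => P)
      {z | ∃ v, (∀ x, |ℓ x v| ≤ F x) ∧ u < ∑ i, (∫ x, |ℓ x v| ^ r ∂P - |ℓ (z i) v| ^ r)}
      ≤ ENNReal.ofReal (4 * (Module.finrank ℝ V * r ^ 2) * n)
        * ∫⁻ x, ENNReal.ofReal (F x ^ (2 * r)) ∂P := by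
  set Θ : Type _ := {v : V // ∀ x, |ℓ x v| ≤ F x} with hΘ
  have : Nonempty Θ := ⟨⟨0, fun x => by simpa using hF0 x⟩⟩
  have : SecondCountableTopology V := secondCountable_of_proper
  have hFr := integrable_rpow_of_two_mul hF0 hFm hI
  have hhm : ∀ v, Measurable fun z => |ℓ z v| ^ r := fun v =>
    (continuous_abs.measurable.comp (hm v)).pow_const r
  have hdom : ∀ (v : Θ) x, ‖|ℓ x v| ^ r‖ ≤ F x ^ r := fun v x => by
    rw [Real.norm_of_nonneg (Real.rpow_nonneg (abs_nonneg _) _)]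
    exact Real.rpow_le_rpow (abs_nonneg _) (v.2 x) (by linarith)
  have hhc : ∀ x, Continuous fun v : Θ => |ℓ x v| ^ r := fun x =>
    (continuous_abs.comp ((ℓ x).continuous_of_finiteDimensional.comp
      continuous_subtype_val)).rpow_const fun _ => Or.inr (by linarith)
  have hint : ∀ v : Θ, Integrable (fun x => |ℓ x v| ^ r) P := fun v =>
    hFr.mono' (hhm v).aestronglyMeasurable (Filter.Eventually.of_forall (hdom v))
  set D : Θ → (Fin n → E) → ℝ := fun v z => ∑ i, (∫ x, |ℓ x v| ^ r ∂P - |ℓ (z i) v| ^ r) with hD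
  have hDc : ∀ z, Continuous fun v => D v z := fun z => by
    refine continuous_finsetSum _ fun i _ => Continuous.sub ?_ (hhc _)
    exact continuous_of_dominated (fun v => (hhm v).aestronglyMeasurable)
      (fun v => Filter.Eventually.of_forall (hdom v)) hFr (Filter.Eventually.of_forall hhc)
  -- The deviation is continuous in v by dominated convergence and the inequality is strict, so a
  -- dense sequence of parameters detects the event. It is covered by increasing finite-index
  -- events, and the moment bound does not depend on their size.
  set A : ℕ → Set (Fin n → E) := fun k => {z | ∃ j ≤ k, u < D (TopologicalSpace.denseSeq Θ j) z}
    with hA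
  have hAmono : Monotone A := fun k l hkl z ⟨j, hj, h⟩ => ⟨j, hj.trans hkl, h⟩
  have hsub : {z : Fin n → E | ∃ v, (∀ x, |ℓ x v| ≤ F x) ∧
      u < ∑ i, (∫ x, |ℓ x v| ^ r ∂P - |ℓ (z i) v| ^ r)} ⊆ ⋃ k, A k := by
    rintro z ⟨v, hv, hz⟩
    obtain ⟨w, hw, j, rfl⟩ := (TopologicalSpace.denseRange_denseSeq Θ).inter_open_nonempty _
      ((hDc z).isOpen_preimage _ (isOpen_Ioi (a := u))) ⟨⟨v, hv⟩, hz⟩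
    exact Set.mem_iUnion.2 ⟨j, j, le_rfl, hw⟩
  refine (mul_le_mul_right (measure_mono hsub) _).trans ?_
  rw [hAmono.measure_iUnion, ENNReal.mul_iSup]
  refine iSup_le fun k => ?_
  have hmain := lintegral_sq_empiricalProcess_le (n := n) (J := Fin (k + 1)) P hr ℓ
    (fun j => (TopologicalSpace.denseSeq Θ j).1) F
    (fun z j => (TopologicalSpace.denseSeq Θ j).2 z) hFm (fun j => hm _) (fun j => hint _)
  refine le_trans ?_ hmain
  have hDm : ∀ v, Measurable (D v) := fun v => Finset.measurable_sum _ fun i _ =>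
    measurable_const.sub ((hhm v).comp (measurable_pi_apply i))
  have hsup : Measurable fun z => ENNReal.ofReal
      (⨆ j : Fin (k + 1), D (TopologicalSpace.denseSeq Θ j) z) ^ 2 :=
    (ENNReal.measurable_ofReal.comp (Measurable.iSup fun j => hDm _)).pow_const 2
  refine le_trans ?_ (mul_meas_ge_le_lintegral hsup (ENNReal.ofReal u ^ 2))
  refine mul_le_mul_right (measure_mono ?_) _
  rintro z ⟨j, hj, hz⟩
  refine pow_le_pow_left' (ENNReal.ofReal_le_ofReal ?_) 2
  exact hz.le.trans (le_ciSup
    (f := fun j : Fin (k + 1) => D (TopologicalSpace.denseSeq Θ j) z)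
    (Set.finite_range _).bddAbove ⟨j, by omega⟩)

/-! ### Dual norms and the envelope -/

/-- Compactness of the unit sphere gives `N` a positive minimum there. The bound makes {N = 1}
bounded, so that the real supremum in `dualNorm` is genuine and not the default 0. -/
theorem exists_norm_le_mul_seminorm {V : Type*} [NormedAddCommGroup V] [NormedSpace ℝ V]
    [FiniteDimensional ℝ V] (N : Seminorm ℝ V) (hN : ∀ z, N z = 0 → z = 0) :
    ∃ K, ∀ w, ‖w‖ ≤ K * N w := by
  have hc : Continuous N := by
    have := (N.convexOn).continuousOn isOpen_univ
    exact continuousOn_univ.1 this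
  have : ProperSpace V := FiniteDimensional.proper_real V
  rcases (Metric.sphere (0 : V) 1).eq_empty_or_nonempty with h | h
  · refine ⟨0, fun w => ?_⟩
    by_contra! hw
    rw [zero_mul] at hw
    have : ‖w‖⁻¹ • w ∈ Metric.sphere (0 : V) 1 := by
      simp [norm_smul, hw.ne']
    rw [h] at this
    exact this
  · obtain ⟨w₀, hw₀, hmin⟩ := (isCompact_sphere (0 : V) 1).exists_isMinOn h hc.continuousOn
    have hpos : 0 < N w₀ := by
      refine lt_of_le_of_ne (apply_nonneg N w₀) fun h0 => ?_
      have := hN w₀ h0.symm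
      simp [this] at hw₀
    refine ⟨(N w₀)⁻¹, fun w => ?_⟩
    rcases eq_or_ne w 0 with rfl | hw
    · simp
    have hw' : 0 < ‖w‖ := norm_pos_iff.2 hw
    have hmem : ‖w‖⁻¹ • w ∈ Metric.sphere (0 : V) 1 := by
      simp [norm_smul, hw'.ne']
    have hle : N w₀ ≤ N (‖w‖⁻¹ • w) := hmin hmem
    rw [map_smul_eq_mul, norm_inv, norm_norm] at hle
    rw [inv_mul_eq_div, le_div_iff₀ hpos]
    calc ‖w‖ * N w₀ ≤ ‖w‖ * (‖w‖⁻¹ * N w) := by gcongr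
      _ = N w := by field_simp

/-- The inner product with a data point as a linear functional. -/
def pairingWith {d : ℕ} (z : Point d) : Point d →ₗ[ℝ] ℝ where
  toFun w := pairing w z
  map_add' v w := by
    simp only [pairing, Prod.fst_add, Prod.snd_add, add_dotProduct]
    ring
  map_smul' a w := by
    simp only [pairing, Prod.smul_fst, Prod.smul_snd, smul_dotProduct, smul_eq_mul,
      RingHom.id_apply]
    ring

theorem pairingWith_apply {d : ℕ} (z w : Point d) : pairingWith z w = pairing w z := rfl

theorem measurable_pairingWith {d : ℕ} (w : Point d) : Measurable fun z => pairingWith z w := by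
  have : Continuous fun z : Point d => w.1 ⬝ᵥ z.1 + w.2 * z.2 := by
    unfold dotProduct
    fun_prop
  exact this.measurable

theorem dualNorm_nonneg_and_abs_pairing_le {d : ℕ} (N : Seminorm ℝ (Point d))
    (hN : ∀ z, N z = 0 → z = 0) (z : Point d) : 0 ≤ dualNorm N z ∧ ∀ w, |pairing w z| ≤ N w * dualNorm N z := by
  obtain ⟨K, hK⟩ := exists_norm_le_mul_seminorm N hN
  set L := LinearMap.toContinuousLinearMap (pairingWith z) with hL
  have hbdd : BddAbove ((fun w => pairing w z) '' {w | N w = 1}) := by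
    refine ⟨‖L‖ * K, ?_⟩
    rintro _ ⟨w, hw, rfl⟩
    have h1 : pairing w z ≤ ‖L‖ * ‖w‖ := (le_abs_self _).trans (L.le_opNorm w)
    have h2 := hK w
    rw [Set.mem_ofPred_eq.mp hw, mul_one] at h2
    exact h1.trans (mul_le_mul_of_nonneg_left h2 (norm_nonneg _))
  have hle : ∀ w, N w = 1 → |pairing w z| ≤ dualNorm N z := fun w hw => by
    -- The set {N = 1} is symmetric, so the one-sided supremum also bounds absolute values.
    refine abs_le'.2 ⟨le_csSup hbdd ⟨w, hw, rfl⟩, ?_⟩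
    refine le_csSup hbdd ⟨-w, by simpa using hw, ?_⟩
    exact map_neg (pairingWith z) w
  refine ⟨?_, fun w => ?_⟩
  · rcases Set.eq_empty_or_nonempty {w | N w = 1} with h | ⟨w, hw⟩
    · simp [dualNorm, h]
    · exact (abs_nonneg _).trans (hle w hw)
  · rcases eq_or_ne (N w) 0 with h | h
    · have := map_zero (pairingWith z)
      rw [pairingWith_apply] at this
      rw [hN w h, this]
      simp
    · have hp : 0 < N w := lt_of_le_of_ne (apply_nonneg N w) h.symm
      have h1 := hle ((N w)⁻¹ • w) (by rw [map_smul_eq_mul, norm_inv, Real.norm_of_nonneg hp.le,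
        inv_mul_cancel₀ h])
      have h2 := map_smul (pairingWith z) (N w)⁻¹ w
      simp only [pairingWith_apply, smul_eq_mul] at h2
      rw [h2, abs_mul, abs_inv, abs_of_pos hp, inv_mul_eq_div, div_le_iff₀ hp] at h1
      linarith

theorem predResidual_eq {d : ℕ} (β : Fin d → ℝ) (z : Point d) :
    predResidual β z = -pairing (β, -1) z := by
  simp only [predResidual, pairing, dotProduct_comm β z.1]
  ring

theorem measurable_predResidual {d : ℕ} (β : Fin d → ℝ) : Measurable (predResidual β) := by
  have : predResidual β = fun z => -pairingWith z (β, -1) := funext fun z => predResidual_eq β z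
  rw [this]
  exact (measurable_pairingWith _).neg

/-- The normalized residuals are dominated by an envelope that does not depend on `β`. -/
theorem abs_pairing_le_envelope {d : ℕ} {c σ : ℝ} (hc : 0 < c) (hσ : 1 ≤ σ)
    (N : Seminorm ℝ (Point d)) (hN : ∀ z, N z = 0 → z = 0)
    (ρ : (Fin d → ℝ) → ℝ) (hρ_nonneg : ∀ γ, 0 ≤ ρ γ) (hρ_zero : ρ 0 = 0)
    (hρ : ∀ γ : Fin d → ℝ, c * N (γ, -1) ≤ ρ γ + 1) (β : Fin d → ℝ) (z : Point d) :
    |pairing (β, -1) z| ≤ max (1 / c) 1 * (σ + ρ β)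
      * (dualNorm N (z.1, 0) + dualNorm N (0, z.2) / σ) := by
  have hA := dualNorm_nonneg_and_abs_pairing_le N hN (z.1, 0)
  have hB := dualNorm_nonneg_and_abs_pairing_le N hN (0, z.2)
  set A := dualNorm N (z.1, 0)
  set B := dualNorm N (0, z.2)
  set κ := max (1 / c) 1
  have hκ : 1 / c ≤ κ := le_max_left _ _
  have hκ0 : 0 ≤ κ := zero_le_one.trans (le_max_right _ _)
  -- The outcome part does not involve β, so its coefficient is controlled by the penalty inequality
  -- at γ = 0. Only this part is divided by σ, and (σ + ρ β)/σ ≥ 1 pays for it.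
  have hsplit : pairing (β, -1) z = pairing (β, -1) (z.1, 0) +
      pairing ((0, -1) : Point d) (0, z.2) := by
    simp [pairing]
  have h1 : N (β, -1) ≤ κ * (σ + ρ β) := by
    have : N (β, -1) ≤ 1 / c * (ρ β + 1) := by
      rw [one_div, inv_mul_eq_div, le_div_iff₀ hc]
      linarith [hρ β]
    refine this.trans (mul_le_mul hκ (by linarith) (by linarith [hρ_nonneg β]) hκ0)
  have h2 : N (0, -1) ≤ κ := by
    refine le_trans ?_ hκ
    have := hρ 0
    rw [hρ_zero] at this
    rw [le_div_iff₀ hc]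
    linarith
  have h3 : κ * B ≤ κ * (σ + ρ β) * (B / σ) := by
    have : B ≤ (σ + ρ β) * (B / σ) := by
      rw [mul_div_assoc', le_div_iff₀ (by linarith)]
      nlinarith [mul_nonneg (hρ_nonneg β) hB.1]
    nlinarith
  calc |pairing (β, -1) z| ≤ |pairing (β, -1) (z.1, 0)| +
        |pairing ((0, -1) : Point d) (0, z.2)| := by
        rw [hsplit]
        exact abs_add_le _ _
    _ ≤ N (β, -1) * A + N (0, -1) * B := add_le_add (hA.2 _) (hB.2 _)
    _ ≤ κ * (σ + ρ β) * A + κ * B := add_le_add (mul_le_mul_of_nonneg_right h1 hA.1)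
        (mul_le_mul_of_nonneg_right h2 hB.1)
    _ ≤ κ * (σ + ρ β) * (A + B / σ) := by linarith

/-- Taking the 1/s-th power recovers measurability of the dual norms from the moment assumptions,
with no separate argument about the supremum. -/
theorem aemeasurable_of_integrable_rpow {E : Type*} [MeasurableSpace E] {P : Measure E} {s : ℝ}
    (hs : 0 < s) {g : E → ℝ} (hg : ∀ z, 0 ≤ g z) (hi : Integrable (fun z => g z ^ s) P) :
    AEMeasurable g P := by
  have := hi.aemeasurable.pow_const (1 / s)
  refine this.congr (Filter.Eventually.of_forall fun z => ?_)
  simp only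
  rw [← Real.rpow_mul (hg z), mul_one_div_cancel hs.ne', Real.rpow_one]

theorem lintegral_enorm_rpow_eq {E : Type*} [MeasurableSpace E] (P : Measure E) {s : ℝ}
    (hs : 0 < s) (g : E → ℝ) :
    ∫⁻ z, ‖g z‖ₑ ^ s ∂P = ∫⁻ z, ENNReal.ofReal (|g z| ^ s) ∂P := by
  refine lintegral_congr fun z => ?_
  rw [Real.enorm_eq_ofReal_abs, ENNReal.ofReal_rpow_of_nonneg (abs_nonneg _) hs.le]

theorem eLpNorm_ofReal_eq {E : Type*} [MeasurableSpace E] (P : Measure E) {s : ℝ}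
    (hs : 0 < s) (g : E → ℝ) :
    eLpNorm g (ENNReal.ofReal s) P = (∫⁻ z, ENNReal.ofReal (|g z| ^ s) ∂P) ^ (1 / s) := by
  rw [eLpNorm_eq_lintegral_rpow_enorm_toReal (by simpa using hs) ENNReal.ofReal_ne_top,
    ENNReal.toReal_ofReal hs.le, lintegral_enorm_rpow_eq P hs]

theorem eLpNorm_le_of_integral_rpow_le {E : Type*} [MeasurableSpace E] {P : Measure E} {s M : ℝ}
    (hs : 0 < s) (hM : 0 ≤ M) {g : E → ℝ} (hg : ∀ z, 0 ≤ g z)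
    (hi : Integrable (fun z => g z ^ s) P) (h : ∫ z, g z ^ s ∂P ≤ M ^ s) :
    eLpNorm g (ENNReal.ofReal s) P ≤ ENNReal.ofReal M := by
  rw [eLpNorm_ofReal_eq P hs]
  simp only [abs_of_nonneg (hg _)]
  rw [← ofReal_integral_eq_lintegral_ofReal hi
    (Filter.Eventually.of_forall fun z => Real.rpow_nonneg (hg z) _)]
  calc _ ≤ ENNReal.ofReal (M ^ s) ^ (1 / s) := by gcongr
    _ = ENNReal.ofReal M := by
      rw [ENNReal.ofReal_rpow_of_nonneg (Real.rpow_nonneg hM _) (by positivity),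
        ← Real.rpow_mul hM, mul_one_div_cancel hs.ne', Real.rpow_one]

/-- The envelope has `2r`-th moment at most `4 ^ r`. -/
theorem lintegral_envelope_rpow_le {E : Type*} [MeasurableSpace E] (P : Measure E)
    [IsProbabilityMeasure P] {r s σ : ℝ} (hr : 1 ≤ r) (hs : 2 * r < s) (hσ : 1 ≤ σ) {A B : E → ℝ}
    (hA : ∀ z, 0 ≤ A z) (hB : ∀ z, 0 ≤ B z) (hAi : Integrable (fun z => A z ^ s) P)
    (hBi : Integrable (fun z => B z ^ s) P) (hA1 : ∫ z, A z ^ s ∂P ≤ 1)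
    (hBσ : (∫ z, B z ^ s ∂P) ^ (1 / s) ≤ σ) :
    ∫⁻ z, ENNReal.ofReal ((A z + B z / σ) ^ (2 * r)) ∂P ≤ ENNReal.ofReal (4 ^ r) := by
  have hs0 : 0 < s := by linarith
  have hσ0 : 0 < σ := by linarith
  have hAm := aemeasurable_of_integrable_rpow hs0 hA hAi
  have hBm := aemeasurable_of_integrable_rpow hs0 hB hBi
  have hBσm : AEMeasurable (fun z => B z / σ) P := hBm.div_const σ
  have hBdiv : ∀ z, (B z / σ) ^ s = B z ^ s / σ ^ s := fun z => Real.div_rpow (hB z) hσ0.le s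
  have hB1 : ∫ z, (B z / σ) ^ s ∂P ≤ 1 ^ s := by
    simp only [hBdiv]
    rw [integral_div, Real.one_rpow, div_le_one (by positivity)]
    have h0 : 0 ≤ ∫ z, B z ^ s ∂P := integral_nonneg fun z => Real.rpow_nonneg (hB z) _
    have := Real.rpow_le_rpow (Real.rpow_nonneg h0 _) hBσ hs0.le
    rwa [← Real.rpow_mul h0, one_div_mul_cancel hs0.ne', Real.rpow_one] at this
  have hBσi : Integrable (fun z => (B z / σ) ^ s) P := by
    simp only [hBdiv]
    exact hBi.div_const _
  have hAe := eLpNorm_le_of_integral_rpow_le hs0 zero_le_one hA hAi (by simpa using hA1)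
  have hBe := eLpNorm_le_of_integral_rpow_le hs0 zero_le_one (fun z => div_nonneg (hB z) hσ0.le)
    hBσi hB1
  -- Both summands have L^s norm at most 1, the second because of the division by σ; the value 2
  -- becomes 2^(2r) = 4^r.
  have hFe : eLpNorm (fun z => A z + B z / σ) (ENNReal.ofReal (2 * r)) P ≤ 2 := by
    calc _ ≤ eLpNorm (fun z => A z + B z / σ) (ENNReal.ofReal s) P :=
          eLpNorm_le_eLpNorm_of_exponent_le (ENNReal.ofReal_le_ofReal hs.le)
            (hAm.add hBσm).aestronglyMeasurable
      _ ≤ eLpNorm A (ENNReal.ofReal s) P + eLpNorm (fun z => B z / σ) (ENNReal.ofReal s) P :=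
          eLpNorm_add_le hAm.aestronglyMeasurable hBσm.aestronglyMeasurable
            (by rw [ENNReal.one_le_ofReal]; linarith)
      _ ≤ 1 + 1 := by
          rw [ENNReal.ofReal_one] at hAe hBe
          exact add_le_add hAe hBe
      _ = 2 := one_add_one_eq_two
  rw [eLpNorm_ofReal_eq P (by linarith)] at hFe
  have h := ENNReal.rpow_le_rpow hFe (show 0 ≤ 2 * r by linarith)
  rw [← ENNReal.rpow_mul, one_div_mul_cancel (by linarith), ENNReal.rpow_one] at h
  have h4 : (2 : ℝ≥0∞) ^ (2 * r) = ENNReal.ofReal (4 ^ r) := by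
    rw [← ENNReal.ofReal_ofNat 2, ENNReal.ofReal_rpow_of_nonneg (by norm_num) (by linarith),
      Real.rpow_mul (by norm_num)]
    norm_num
  rw [h4] at h
  refine le_trans (le_of_eq (lintegral_congr fun z => ?_)) h
  rw [abs_of_nonneg (add_nonneg (hA z) (div_nonneg (hB z) hσ0.le))]

/-! ### From moments to L^r norms, and change of distribution -/

theorem lintegral_empiricalMeasure {E : Type*} [MeasurableSpace E] {n : ℕ} (z : Fin n → E)
    {f : E → ℝ≥0∞} (hf : Measurable f) :
    ∫⁻ x, f x ∂(empiricalMeasure z) = (n : ℝ≥0∞)⁻¹ * ∑ i, f (z i) := by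
  rw [empiricalMeasure, lintegral_smul_measure, lintegral_finsetSum_measure, smul_eq_mul]
  simp only [lintegral_dirac' _ hf]

/-- A deviation bound for `r`-th moments gives one for the `L^r` norms. -/
theorem eLpNorm_le_empirical_add {E : Type*} [MeasurableSpace E] {P : Measure E} {n : ℕ}
    (hn : 1 ≤ n) {r X : ℝ} (hr : 1 ≤ r) (hX : 0 ≤ X) {f : E → ℝ} (hf : Measurable f)
    (hi : Integrable (fun x => |f x| ^ r) P) (z : Fin n → E)
    (h : ∑ i, (∫ x, |f x| ^ r ∂P - |f (z i)| ^ r) ≤ n * X) :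
    eLpNorm f (ENNReal.ofReal r) P
      ≤ eLpNorm f (ENNReal.ofReal r) (empiricalMeasure z) + ENNReal.ofReal (X ^ (1 / r)) := by
  have hr0 : 0 < r := by linarith
  have hn0 : (0 : ℝ) < n := by exact_mod_cast hn
  have hnn : ∀ x, 0 ≤ |f x| ^ r := fun x => Real.rpow_nonneg (abs_nonneg _) _
  have hm : Measurable fun x => ENNReal.ofReal (|f x| ^ r) :=
    ((continuous_abs.measurable.comp hf).pow_const r).ennreal_ofReal
  rw [eLpNorm_ofReal_eq P hr0, eLpNorm_ofReal_eq _ hr0,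
    ← ofReal_integral_eq_lintegral_ofReal hi (Filter.Eventually.of_forall hnn),
    lintegral_empiricalMeasure z hm,
    ← ENNReal.ofReal_rpow_of_nonneg hX (by positivity)]
  have hle : ∫ x, |f x| ^ r ∂P ≤ (n : ℝ)⁻¹ * ∑ i, |f (z i)| ^ r + X := by
    rw [Finset.sum_sub_distrib, Finset.sum_const, Finset.card_univ, Fintype.card_fin,
      nsmul_eq_mul] at h
    rw [inv_mul_eq_div, div_add' _ _ _ hn0.ne', le_div_iff₀ hn0]
    linarith
  have hconv : (n : ℝ≥0∞)⁻¹ * ∑ i, ENNReal.ofReal (|f (z i)| ^ r)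
      = ENNReal.ofReal ((n : ℝ)⁻¹ * ∑ i, |f (z i)| ^ r) := by
    rw [ENNReal.ofReal_mul (by positivity), ENNReal.ofReal_inv_of_pos hn0, ENNReal.ofReal_natCast,
      ENNReal.ofReal_sum_of_nonneg fun i _ => hnn _]
  rw [hconv]
  -- Subadditivity of t ↦ t^(1/r), valid since 1/r ≤ 1.
  refine le_trans ?_ (ENNReal.rpow_add_le_add_rpow _ _ (by positivity)
    (by rw [div_le_one hr0]; exact hr))
  gcongr
  rw [← ENNReal.ofReal_add (mul_nonneg (by positivity) (Finset.sum_nonneg fun i _ => hnn _)) hX]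
  exact ENNReal.ofReal_le_ofReal hle

/-- Prediction errors under two distributions differ by at most their max-sliced distance. -/
theorem predictionError_le_add_rhoMSW {d : ℕ} {r σ : ℝ} (hr : 1 ≤ r)
    (ρ : (Fin d → ℝ) → ℝ) (P Q : Measure (Point d)) (β : Fin d → ℝ) (hpos : 0 < σ + ρ β) :
    predictionError r Q β
      ≤ predictionError r P β + rhoMSW r ρ σ P Q * ENNReal.ofReal (σ + ρ β) := by
  have hk0 : ENNReal.ofReal (σ + ρ β) ≠ 0 := by simpa using hpos
  have hmeas := measurable_predResidual β
  rw [← tsub_le_iff_left, ← ENNReal.div_le_iff hk0 ENNReal.ofReal_ne_top]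
  refine le_trans (le_iInf₂ fun π hπ => ?_) (le_iSup (fun γ : Fin d → ℝ =>
    ⨅ (π : Measure (Point d × Point d)) (_ : IsCoupling π P Q),
      eLpNorm (fun zz => predResidual γ zz.1 - predResidual γ zz.2) (ENNReal.ofReal r) π
        / ENNReal.ofReal (σ + ρ γ)) β)
  gcongr
  rw [tsub_le_iff_left, predictionError, predictionError, ← hπ.1, ← hπ.2, Measure.fst,
    Measure.snd, eLpNorm_map_measure hmeas.aestronglyMeasurable measurable_fst.aemeasurable,
    eLpNorm_map_measure hmeas.aestronglyMeasurable measurable_snd.aemeasurable]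
  have h1 : AEStronglyMeasurable (predResidual β ∘ Prod.fst : Point d × Point d → ℝ) π :=
    (hmeas.comp measurable_fst).aestronglyMeasurable
  have h2 : AEStronglyMeasurable (predResidual β ∘ Prod.snd : Point d × Point d → ℝ) π :=
    (hmeas.comp measurable_snd).aestronglyMeasurable
  -- The residual under Q is the residual under P minus their difference, on the common space of the
  -- coupling.
  have := eLpNorm_sub_le h1 (h1.sub h2) (p := ENNReal.ofReal r) (by simpa using hr)
  rw [sub_sub_cancel] at this
  exact this

/-! ### Constants and probabilities -/

/-- The third summand of C suffices: √(2^s) absorbs the denominator v = s/2 - r because v ≤ 2^v ≤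
2^(s/2), and log(8/α) ≥ 0 can be dropped. -/
theorem le_pivotalConstant {r s α : ℝ} (hr : 1 ≤ r) (hs : 2 * r < s) (hα₀ : 0 < α) (hα₁ : α < 1)
    (d : ℕ) : 2 ^ r * r * (8 * √(((d : ℝ) + 2) / α)) ≤ pivotalConstant r s α d := by
  rw [pivotalConstant]
  refine mul_le_mul_of_nonneg_left ?_ (by positivity)
  have hv : 0 < s / 2 - r := by linarith
  set v := s / 2 - r with hvdef
  have hv2 : v ≤ 2 ^ v := by
    rcases le_total v 1 with h | h
    · exact h.trans (Real.one_le_rpow one_le_two hv.le)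
    · have := one_add_mul_self_le_rpow_one_add (show (-1 : ℝ) ≤ 1 by norm_num) h
      norm_num at this
      linarith
  have hsq : v ≤ √(2 ^ s) := by
    refine Real.le_sqrt_of_sq_le ?_
    calc v ^ 2 ≤ (2 ^ v) ^ 2 := pow_le_pow_left₀ hv.le hv2 2
      _ = 2 ^ (v * 2) := by rw [Real.rpow_mul (by norm_num)]; norm_num
      _ ≤ 2 ^ s := Real.rpow_le_rpow_of_exponent_le one_le_two (by rw [hvdef]; linarith)
  have hlog : 0 ≤ Real.log (8 / α) := Real.log_nonneg (by rw [le_div_iff₀ hα₀]; linarith)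
  have h3 : 8 * √(((d : ℝ) + 2) / α)
      ≤ √(2 ^ s / α) * (8 / v) * √(Real.log (8 / α) + ((d : ℝ) + 2)) := by
    have ha : √((d : ℝ) + 2) ≤ √(Real.log (8 / α) + ((d : ℝ) + 2)) :=
      Real.sqrt_le_sqrt (by linarith)
    have hb : 1 ≤ √(2 ^ s) / v := by rwa [le_div_iff₀ hv, one_mul]
    rw [Real.sqrt_div (by positivity), Real.sqrt_div (by positivity)]
    calc 8 * (√((d : ℝ) + 2) / √α) = 1 * (8 / √α * √((d : ℝ) + 2)) := by ring
      _ ≤ √(2 ^ s) / v * (8 / √α * √(Real.log (8 / α) + ((d : ℝ) + 2))) := by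
        gcongr
      _ = _ := by ring
  have h1 : 0 ≤ 180 * √((d : ℝ) + 2) := by positivity
  have h2 : 0 ≤ √(2 * Real.log (1 / α)) := Real.sqrt_nonneg _
  linarith

/-- Complements of sets covered by the preimage of a small set have large measure. -/
theorem one_sub_le_measureReal_of_hasLaw {Ω E : Type*} [MeasurableSpace Ω] [MeasurableSpace E]
    {μ : Measure Ω} [IsProbabilityMeasure μ] {ν : Measure E} [IsFiniteMeasure ν] {f : Ω → E}
    (hf : HasLaw f ν μ) (T : Set E) (S : Set Ω) (hTS : ∀ ω, f ω ∉ T → ω ∈ S) :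
    1 - ν.real T ≤ μ.real S := by
  -- T need not be measurable; its measurable hull has the same measure and a null-measurable
  -- preimage computed by the law.
  have hT : μ.real (f ⁻¹' toMeasurable ν T) = ν.real T := by
    rw [measureReal_def, measureReal_def, ← measure_toMeasurable T]
    congr 1
    have := Measure.map_apply_of_aemeasurable hf.aemeasurable (measurableSet_toMeasurable ν T)
    rw [hf.map_eq] at this
    exact this.symm
  have hcover : (Set.univ : Set Ω) ⊆ f ⁻¹' toMeasurable ν T ∪ S := fun ω _ => by
    by_cases h : f ω ∈ toMeasurable ν T
    · exact Or.inl h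
    · exact Or.inr (hTS ω fun h' => h (subset_toMeasurable ν T h'))
  have h1 := measureReal_mono (μ := μ) hcover
  have h2 := measureReal_union_le (μ := μ) (f ⁻¹' toMeasurable ν T) S
  rw [probReal_univ] at h1
  rw [hT] at h2
  linarith

/-- The numerical estimate turning the second-moment bound into a probability bound. -/
theorem probability_bound {d n : ℕ} (hn : 1 ≤ n) {r s α p X : ℝ} (hr : 1 ≤ r) (hs : 2 * r < s)
    (hα₀ : 0 < α) (hα₁ : α < 1)
    (hX : X = pivotalConstant r s α d * Real.log (2 * (n : ℝ) + 1) ^ (r / s) / √(n : ℝ))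
    (hp : (n * X) ^ 2 * p ≤ 4 * (((d : ℝ) + 1) * r ^ 2) * n * 4 ^ r) : p < 3 * α := by
  have hn1 : (1 : ℝ) ≤ n := by exact_mod_cast hn
  have hn0 : (0 : ℝ) < n := by linarith
  have hd0 : (0 : ℝ) ≤ d := d.cast_nonneg
  have hr0 : 0 < r := by linarith
  have h4 : (4 : ℝ) ^ r = (2 ^ r) ^ 2 := by
    rw [← Real.rpow_mul_natCast (by norm_num), mul_comm, Real.rpow_mul (by norm_num)]
    norm_num
  set C := pivotalConstant r s α d
  have hC : 2 ^ r * r * (8 * √(((d : ℝ) + 2) / α)) ≤ C := le_pivotalConstant hr hs hα₀ hα₁ d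
  have hC2 : (2 ^ r) ^ 2 * r ^ 2 * (64 * (((d : ℝ) + 2) / α)) ≤ C ^ 2 := by
    have := pow_le_pow_left₀ (by positivity) hC 2
    rwa [mul_pow, mul_pow, mul_pow, Real.sq_sqrt (by positivity),
      show (8 : ℝ) ^ 2 = 64 by norm_num] at this
  -- Since 2n + 1 ≥ 3 > e, the logarithmic factor is at least 1 and can be discarded.
  have hlog : 1 ≤ Real.log (2 * (n : ℝ) + 1) := by
    rw [Real.le_log_iff_exp_le (by linarith)]
    linarith [Real.exp_one_lt_d9]
  have hL : 1 ≤ Real.log (2 * (n : ℝ) + 1) ^ (r / s) :=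
    Real.one_le_rpow hlog (div_nonneg hr0.le (by linarith))
  have hnX : C ^ 2 ≤ n * X ^ 2 := by
    rw [hX, div_pow, Real.sq_sqrt hn0.le, mul_div_cancel₀ _ hn0.ne', mul_pow]
    exact le_mul_of_one_le_right (sq_nonneg _) (one_le_pow₀ hL)
  -- If p ≥ 3α, the factor 64(d+2)/α in C² would force 192(d+2) ≤ 4(d+1).
  by_contra! hcon
  have hp0 : 0 ≤ p := by linarith
  have h1 : n * X ^ 2 * p ≤ 4 * (((d : ℝ) + 1) * r ^ 2) * (2 ^ r) ^ 2 := by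
    rw [h4] at hp
    have : n * (n * X ^ 2 * p) ≤ n * (4 * (((d : ℝ) + 1) * r ^ 2) * (2 ^ r) ^ 2) := by linarith
    exact le_of_mul_le_mul_left this hn0
  have h2 : (2 ^ r) ^ 2 * r ^ 2 * (64 * (((d : ℝ) + 2) / α)) * (3 * α)
      ≤ 4 * (((d : ℝ) + 1) * r ^ 2) * (2 ^ r) ^ 2 :=
    (mul_le_mul (hC2.trans hnX) hcon (by positivity) (by positivity)).trans h1
  have h3 : (2 ^ r) ^ 2 * r ^ 2 * (64 * (((d : ℝ) + 2) / α)) * (3 * α)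
      = (2 ^ r) ^ 2 * r ^ 2 * (192 * ((d : ℝ) + 2)) := by
    field_simp
    ring
  rw [h3] at h2
  have hK : (0 : ℝ) < (2 ^ r) ^ 2 * r ^ 2 := by positivity
  have : (2 ^ r) ^ 2 * r ^ 2 * (192 * ((d : ℝ) + 2))
      ≤ (2 ^ r) ^ 2 * r ^ 2 * (4 * ((d : ℝ) + 1)) := by linarith
  have := le_of_mul_le_mul_left this hK
  linarith

/-- Rescaling the deviation bound of the normalized residual. -/
theorem predictionError_le_empirical_add {d n : ℕ} (hn : 1 ≤ n) {r X k : ℝ} (hr : 1 ≤ r)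
    (hX : 0 ≤ X) (hk : 0 < k) {P : Measure (Point d)} (β : Fin d → ℝ)
    (hi : Integrable (fun x => |pairingWith x (k⁻¹ • (β, -1))| ^ r) P) (z : Fin n → Point d)
    (h : ∑ i, (∫ x, |pairingWith x (k⁻¹ • (β, -1))| ^ r ∂P
      - |pairingWith (z i) (k⁻¹ • (β, -1))| ^ r) ≤ n * X) :
    predictionError r P β ≤ predictionError r (empiricalMeasure z) β
      + ENNReal.ofReal (k * X ^ (1 / r)) := by
  have hres : predResidual β = (-k) • fun x => pairingWith x (k⁻¹ • (β, -1)) := by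
    funext x
    simp only [Pi.smul_apply, map_smul, smul_eq_mul, pairingWith_apply, predResidual_eq]
    field_simp
  have hmain := eLpNorm_le_empirical_add hn hr hX (measurable_pairingWith _) hi z h
  have hnorm : ‖-k‖ₑ = ENNReal.ofReal k := by
    rw [enorm_neg, Real.enorm_of_nonneg hk.le]
  rw [predictionError, predictionError, hres, eLpNorm_const_smul, eLpNorm_const_smul, hnorm,
    ENNReal.ofReal_mul hk.le, ← mul_add]
  gcongr

end RhoMSW

/-! ### Assembly -/

theorem theorem7
    {d n : ℕ} (hn : 1 ≤ n)
    {r s α c : ℝ} (hr : 1 ≤ r) (hs : 2 * r < s) (hα₀ : 0 < α) (hα₁ : α < 1) (hc : 0 < c)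
    -- an arbitrary norm on `ℝ^(d+1)`
    (N : Seminorm ℝ (RhoMSW.Point d)) (hN : ∀ z, N z = 0 → z = 0)
    -- the penalty function
    (ρ : (Fin d → ℝ) → ℝ) (hρ_nonneg : ∀ γ, 0 ≤ ρ γ) (hρ_zero : ρ 0 = 0)
    (hρ : ∀ γ : Fin d → ℝ, c * N (γ, -1) ≤ ρ γ + 1)
    -- the data distribution, with normalized covariates
    (P : Measure (RhoMSW.Point d)) [IsProbabilityMeasure P]
    (hX : ∫ z, RhoMSW.dualNorm N (z.1, 0) ^ s ∂P = 1)
    (hY : Integrable (fun z => RhoMSW.dualNorm N (0, z.2) ^ s) P)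
    (σ : ℝ) (hσ : σ = max ((∫ z, RhoMSW.dualNorm N (0, z.2) ^ s ∂P) ^ (1 / s)) 1)
    -- the i.i.d. sample from `P`
    {Ω : Type*} [MeasurableSpace Ω] (μ : Measure Ω) [IsProbabilityMeasure μ]
    (Z : Fin n → Ω → RhoMSW.Point d)
    (hZ_law : ∀ i, HasLaw (Z i) P μ) (hZ_indep : iIndepFun Z μ)
    -- the testing distribution
    (ε : ℝ) (hε : 0 ≤ ε)
    (Q : Measure (RhoMSW.Point d)) [IsProbabilityMeasure Q]
    (hQ : RhoMSW.rhoMSW r ρ σ P Q ≤ ENNReal.ofReal ε) :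
    1 - 3 * α <
      μ.real {ω | ∀ β : Fin d → ℝ,
        RhoMSW.predictionError r Q β ≤
          RhoMSW.predictionError r (RhoMSW.empiricalMeasure (fun i => Z i ω)) β
            + ENNReal.ofReal ((RhoMSW.pivotalRadius r s α c d n + ε) * (σ + ρ β))} := by
  have hr0 : 0 < r := by linarith
  have hs0 : 0 < s := by linarith
  have hn0 : (0 : ℝ) < n := by exact_mod_cast hn
  have hσ1 : 1 ≤ σ := hσ ▸ le_max_right _ _
  have hσ0 : 0 < σ := by linarith
  set A : RhoMSW.Point d → ℝ := fun z => RhoMSW.dualNorm N (z.1, 0) with hAdef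
  set B : RhoMSW.Point d → ℝ := fun z => RhoMSW.dualNorm N (0, z.2) with hBdef
  have hA : ∀ z, 0 ≤ A z := fun z => (RhoMSW.dualNorm_nonneg_and_abs_pairing_le N hN _).1
  have hB : ∀ z, 0 ≤ B z := fun z => (RhoMSW.dualNorm_nonneg_and_abs_pairing_le N hN _).1
  -- A nonintegrable function has Bochner integral 0, which the normalization to 1 excludes.
  have hAi : Integrable (fun z => A z ^ s) P := by
    by_contra h
    rw [integral_undef h] at hX
    exact zero_ne_one hX
  set F : RhoMSW.Point d → ℝ := fun z => A z + B z / σ with hFdef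
  have hF0 : ∀ z, 0 ≤ F z := fun z => add_nonneg (hA z) (div_nonneg (hB z) hσ0.le)
  have hFm : AEMeasurable F P := (RhoMSW.aemeasurable_of_integrable_rpow hs0 hA hAi).add
    ((RhoMSW.aemeasurable_of_integrable_rpow hs0 hB hY).div_const σ)
  have hFmom : ∫⁻ z, ENNReal.ofReal (F z ^ (2 * r)) ∂P ≤ ENNReal.ofReal (4 ^ r) :=
    RhoMSW.lintegral_envelope_rpow_le P hr hs hσ1 hA hB hAi hY hX.le (hσ ▸ le_max_left _ _)
  set X := RhoMSW.pivotalConstant r s α d * Real.log (2 * (n : ℝ) + 1) ^ (r / s) / √(n : ℝ)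
    with hXdef
  have hX0 : 0 ≤ X := by
    have hC : 0 ≤ RhoMSW.pivotalConstant r s α d :=
      le_trans (by positivity) (RhoMSW.le_pivotalConstant hr hs hα₀ hα₁ d)
    have : 0 ≤ Real.log (2 * (n : ℝ) + 1) := Real.log_nonneg (by linarith)
    positivity
  -- The bad event ranges over every v dominated by the envelope, so a single exceptional set serves
  -- all β at once.
  set T : Set (Fin n → RhoMSW.Point d) := {z | ∃ v, (∀ x, |RhoMSW.pairingWith x v| ≤ F x) ∧
    n * X < ∑ i, (∫ x, |RhoMSW.pairingWith x v| ^ r ∂P - |RhoMSW.pairingWith (z i) v| ^ r)}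
    with hTdef
  have hT : (Measure.pi fun _ : Fin n => P).real T < 3 * α := by
    refine RhoMSW.probability_bound hn hr hs hα₀ hα₁ hXdef ?_
    have hdev := RhoMSW.measure_uniform_deviation_le (n := n) P hr RhoMSW.pairingWith F hF0 hFm
      RhoMSW.measurable_pairingWith (hFmom.trans_lt ENNReal.ofReal_lt_top).ne (n * X)
    have hdim : (Module.finrank ℝ (RhoMSW.Point d) : ℝ) = d + 1 := by
      simp [RhoMSW.Point]
    rw [hdim] at hdev
    have hdev' := hdev.trans (mul_le_mul_right hFmom _)
    rw [← ENNReal.ofReal_mul (by positivity)] at hdev'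
    have := ENNReal.toReal_mono ENNReal.ofReal_ne_top hdev'
    rwa [ENNReal.toReal_mul, ENNReal.toReal_pow, ENNReal.toReal_ofReal (by positivity),
      ENNReal.toReal_ofReal (by positivity)] at this
  refine lt_of_lt_of_le (by linarith) (RhoMSW.one_sub_le_measureReal_of_hasLaw
    (hZ_indep.hasLaw_pi hZ_law) T _ fun ω hω β => ?_)
  have hσρ : 0 < σ + ρ β := by linarith [hρ_nonneg β]
  set k := max (1 / c) 1 * (σ + ρ β) with hkdef
  have hk : 0 < k := mul_pos (lt_of_lt_of_le one_pos (le_max_right _ _)) hσρ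
  -- The normalization k places v below the envelope; undoing it multiplies X^(1/r) by k, which is
  -- `pivotalRadius` times σ + ρ β.
  set v : RhoMSW.Point d := k⁻¹ • (β, -1) with hv
  have hvF : ∀ x, |RhoMSW.pairingWith x v| ≤ F x := fun x => by
    rw [hv, map_smul, smul_eq_mul, abs_mul, abs_inv, abs_of_pos hk, inv_mul_eq_div,
      div_le_iff₀ hk, mul_comm]
    exact RhoMSW.abs_pairing_le_envelope hc hσ1 N hN ρ hρ_nonneg hρ_zero hρ β x
  have hvi : Integrable (fun x => |RhoMSW.pairingWith x v| ^ r) P := by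
    refine (RhoMSW.integrable_rpow_of_two_mul hF0 hFm
      (hFmom.trans_lt ENNReal.ofReal_lt_top).ne).mono'
      ((continuous_abs.measurable.comp (RhoMSW.measurable_pairingWith v)).pow_const
        r).aestronglyMeasurable (Filter.Eventually.of_forall fun x => ?_)
    rw [Real.norm_of_nonneg (Real.rpow_nonneg (abs_nonneg _) _)]
    exact Real.rpow_le_rpow (abs_nonneg _) (hvF x) hr0.le
  have hemp := RhoMSW.predictionError_le_empirical_add hn hr hX0 hk β hvi (fun i => Z i ω)
    (not_lt.1 fun h => hω ⟨v, hvF, h⟩)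
  have hQP := RhoMSW.predictionError_le_add_rhoMSW hr ρ P Q β hσρ
  have hε' : RhoMSW.rhoMSW r ρ σ P Q * ENNReal.ofReal (σ + ρ β)
      ≤ ENNReal.ofReal (ε * (σ + ρ β)) := by
    rw [ENNReal.ofReal_mul hε]
    gcongr
  refine (hQP.trans (add_le_add hemp hε')).trans_eq ?_
  rw [add_assoc, ← ENNReal.ofReal_add (by positivity) (by positivity), RhoMSW.pivotalRadius,
    ← hXdef, hkdef]
  congr 2
  ring
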